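/- Let $\mu$ be a probability distribution with compact support on the space $\mathbb{R}^{d\times d}$ of real $d\times d$ matrices, let $\mathcal M=\operatorname{supp}\mu$, and let $A$ be a random matrix with law $\mu$. Assume that (a) $\mathcal M$ leaves a proper cone invariant: there is a set $K\subset\mathbb{R}^d$ that is closed under multiplication by nonnegative scalars, topologically closed, convex, has nonempty interior and contains no line ($x,-x\in K$ implies $x=0$), such that $MK\subset K$ for every $M\in\mathcal M$; (b) the singular part $\mu_s$ of $\mu$ with respect to Lebesgue measure on $\mathbb{R}^{d\times d}$ consists of only finitely many (possibly no) point measures: $\mu_s=\sum_{i=1}^N p_i\delta_{M_i}$ with $N\ge 0$, $p_i>0$ and $M_i\in\mathbb{R}^{d\times d}$. Let $\|\cdot\|$ be any norm on $\mathbb{R}^{d\times d}$ and let $$\hat\rho(\mathcal M)=\limsup_{k\to\infty}\ \sup_{A_1,\dots,A_k\in\mathcal M}\|A_k\cdots A_1\|^{1/k}$$ be the joint spectral radius of $\mathcal M$. Then $\hat\rho(\mathcal M)$ is finite and $$\hat\rho(\mathcal M)=\lim_{p\to\infty}\rho\left(E[A^{\otimes p}]\right)^{1/p},$$ where $p$ runs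 over the positive integers, $A^{\otimes p}\in\mathbb{R}^{d^p\times d^p}$ is the $p$-th Kronecker power ($A^{\otimes 1}=A$, $A^{\otimes p}=A^{\otimes (p-1)}\otimes A$) and $\rho$ denotes the spectral radius of a matrix (the largest modulus of its complex eigenvalues). In particular, the limit exists. -/

import Mathlib

open MeasureTheory Filter Topology
open scoped ENNReal Kronecker

section MatrixMeasure

/-- The product (equivalently, Borel) σ-algebra on `ℝ^{d×d}`. -/
instance matrixMeasurableSpace (d : ℕ) : MeasurableSpace (Matrix (Fin d) (Fin d) ℝ) :=
  inferInstanceAs (MeasurableSpace (Fin d → Fin d → ℝ))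

instance matrixBorelSpace (d : ℕ) : BorelSpace (Matrix (Fin d) (Fin d) ℝ) :=
  inferInstanceAs (BorelSpace (Fin d → Fin d → ℝ))

/-- Lebesgue measure on `ℝ^{d×d}`, identified entrywise with the `d²`-fold product of `ℝ`. -/
noncomputable def matrixLebesgue (d : ℕ) : Measure (Matrix (Fin d) (Fin d) ℝ) :=
  (volume : Measure (Fin d → Fin d → ℝ))

end MatrixMeasure

/-- A proper cone in `ℝ^d`: closed under multiplication by nonnegative scalars, topologically
closed, convex, with nonempty interior, and containing no line. -/
structure IsProperCone {d : ℕ} (K : Set (Fin d → ℝ)) : Prop where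
  smul_mem : ∀ c : ℝ, 0 ≤ c → ∀ x ∈ K, c • x ∈ K
  isClosed : IsClosed K
  convex : Convex ℝ K
  solid : (interior K).Nonempty
  pointed : ∀ x : Fin d → ℝ, x ∈ K → -x ∈ K → x = 0

/-- The set `S` of matrices leaves `K` invariant: `M K ⊆ K` for every `M ∈ S`. -/
def LeavesInvariant {d : ℕ} (S : Set (Matrix (Fin d) (Fin d) ℝ)) (K : Set (Fin d → ℝ)) : Prop :=
  ∀ M ∈ S, ∀ x ∈ K, M.mulVec x ∈ K

/-- The singular part of `μ` with respect to Lebesgue measure is a finite (possibly empty) sum of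
positive multiples of point measures. -/
def SingularPartIsFinitelyAtomic {d : ℕ} (μ : Measure (Matrix (Fin d) (Fin d) ℝ)) : Prop :=
  ∃ (N : ℕ) (w : Fin N → ℝ) (M : Fin N → Matrix (Fin d) (Fin d) ℝ),
    (∀ i, 0 < w i) ∧
      μ.singularPart (matrixLebesgue d) = ∑ i, ENNReal.ofReal (w i) • Measure.dirac (M i)

/-- The joint spectral radius of a set `S` of matrices, computed with the norm `ν`:
`limsup_{k → ∞} sup_{A_1, …, A_k ∈ S} ν(A_k ⋯ A_1)^{1/k}`, as an extended nonnegative number.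
`A 0, …, A (k - 1)` play the roles of `A_1, …, A_k`. -/
noncomputable def jointSpectralRadius {d : ℕ} (ν : Seminorm ℝ (Matrix (Fin d) (Fin d) ℝ))
    (S : Set (Matrix (Fin d) (Fin d) ℝ)) : ℝ≥0∞ :=
  limsup (fun k : ℕ =>
    ⨆ (A : Fin k → Matrix (Fin d) (Fin d) ℝ) (_ : ∀ i, A i ∈ S),
      ENNReal.ofReal (ν (List.ofFn fun i : Fin k => A i.rev).prod) ^ (1 / (k : ℝ))) atTop

/-- The Kronecker power `M^{⊗p} ∈ ℝ^{d^p × d^p}`, with `M^{⊗(p+1)} = M^{⊗p} ⊗ M`, rows and columns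
numbered lexicographically as usual for the Kronecker product. The value at `p = 0` is the `1 × 1`
identity matrix, so that `M^{⊗1}` is `M`. -/
noncomputable def kroneckerPow {d : ℕ} (M : Matrix (Fin d) (Fin d) ℝ) :
    (p : ℕ) → Matrix (Fin (d ^ p)) (Fin (d ^ p)) ℝ
  | 0 => 1
  | p + 1 => Matrix.reindex finProdFinEquiv finProdFinEquiv (kroneckerPow M p ⊗ₖ M)

theorem kroneckerPow_one {d : ℕ} (M : Matrix (Fin d) (Fin d) ℝ) :
    kroneckerPow M 1 =
      Matrix.reindex (finCongr (pow_one d).symm) (finCongr (pow_one d).symm) M := by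
  have key : ∀ i : Fin (d ^ 1),
      (finProdFinEquiv.symm i : Fin (d ^ 0) × Fin d).2 = finCongr (pow_one d) i := by
    intro i
    have hi : (i : ℕ) < d := by simpa using i.2
    ext
    change (i : ℕ) % d = i
    exact Nat.mod_eq_of_lt hi
  have h1 : ∀ a b : Fin (d ^ 0), (kroneckerPow M 0) a b = 1 := by
    intro a b
    have hab : a = b := Subsingleton.elim (α := Fin 1) a b
    subst hab
    exact Matrix.one_apply_eq a
  ext i j
  change (kroneckerPow M 0) (finProdFinEquiv.symm i).1 (finProdFinEquiv.symm j).1 *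
    M (finProdFinEquiv.symm i).2 (finProdFinEquiv.symm j).2 = _
  rw [h1, key, key, one_mul]
  rfl

/-- The matrix `E[A^{⊗p}]`, where `A` has law `μ`; expectations are taken entrywise. -/
noncomputable def expectedKroneckerPow {d : ℕ} (μ : Measure (Matrix (Fin d) (Fin d) ℝ)) (p : ℕ) :
    Matrix (Fin (d ^ p)) (Fin (d ^ p)) ℝ :=
  Matrix.of fun i j => ∫ X, kroneckerPow X p i j ∂μ

/-- The spectral radius of a real square matrix: the largest modulus of its complex eigenvalues. -/
noncomputable def matrixSpectralRadius {n : ℕ} (M : Matrix (Fin n) (Fin n) ℝ) : ℝ≥0∞ :=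
  spectralRadius ℂ (M.map (algebraMap ℝ ℂ))

/-!
Expanding `E[A^{⊗p}] ^ k` as an expectation over products of `k` matrices of the support bounds its
spectral radius by the `p`-th power of any number above the joint spectral radius.

Conversely, let `y` be a functional with `‖x‖ ≤ y · x` on the cone `K`, let
`q > ρ(E[A^{⊗p}])`, and let `Φ x = w · x^{⊗p}`, where `w` is the Neumann series
`∑ k, q^{-k} (y^{⊗p}) E[A^{⊗p}]^k`. Then `Φ x = (y · x)^p + q⁻¹ E[Φ (A x)]`, so that
`‖x‖^p ≤ Φ x` and `E[Φ (A x)] ≤ q Φ x` on `K`; moreover `Φ` is convex, homogeneous of degree `p` and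
monotone with respect to `K`. A bound on the mean of `Φ (A x)` becomes a bound for every `M` of the
support if `M ≤ B + ε A` in the order of cone-preserving matrices for all `B`, `A` in sets of
probability at least `m = m(ε)`: picking `B` and `A` with `Φ (B x)`, `Φ (A x) ≤ (q / m) Φ x` gives
`Φ (M x) ≤ (1 + ε)^p (q / m) Φ x`. Since `m` does not depend on `p`, its `p`-th root tends to `1`.

Such a domination holds, with `B` near `M` and `A` near an interior point, as soon as the support
meets the interior of the convex set of matrices preserving `K`. Otherwise the support lies in the
frontier of that set, which is Lebesgue null, so `μ` is singular and hence finitely atomic, and one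
takes `A = B = M`.
-/

/-! ### Proper cones -/

namespace IsProperCone

variable {d : ℕ} {K : Set (Fin d → ℝ)}

theorem zero_mem (hK : IsProperCone K) : (0 : Fin d → ℝ) ∈ K := by
  obtain ⟨x, hx⟩ := hK.solid
  simpa using hK.smul_mem 0 le_rfl x (interior_subset hx)

theorem add_mem (hK : IsProperCone K) {x y : Fin d → ℝ} (hx : x ∈ K) (hy : y ∈ K) :
    x + y ∈ K := by
  have h := hK.smul_mem 2 zero_le_two _ (hK.convex hx hy (a := 1 / 2) (b := 1 / 2)
    (by norm_num) (by norm_num) (by norm_num))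
  simpa [smul_add, smul_smul] using h

theorem exists_functional_pos (hK : IsProperCone K) {x : Fin d → ℝ} (hx : x ∈ K) (hx0 : x ≠ 0) :
    ∃ f : StrongDual ℝ (Fin d → ℝ), (∀ z ∈ K, 0 ≤ f z) ∧ 0 < f x := by
  let C : ProperCone ℝ (Fin d → ℝ) :=
    { carrier := K
      add_mem' := hK.add_mem
      zero_mem' := hK.zero_mem
      smul_mem' := fun c _ hz => hK.smul_mem c c.2 _ hz
      isClosed' := hK.isClosed }
  have hnot : -x ∉ C := fun h => hx0 (hK.pointed x hx h)
  obtain ⟨f, hf, hfx⟩ := C.hyperplane_separation_point hnot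
  exact ⟨f, hf, by simpa using hfx⟩

theorem exists_functional_pos_of_isCompact (hK : IsProperCone K) {s : Set (Fin d → ℝ)}
    (hs : IsCompact s) (hsK : s ⊆ K) (hs0 : 0 ∉ s) :
    ∃ f : StrongDual ℝ (Fin d → ℝ), (∀ z ∈ K, 0 ≤ f z) ∧ ∀ z ∈ s, 0 < f z := by
  suffices ∃ f : StrongDual ℝ (Fin d → ℝ), (∀ z ∈ K, 0 ≤ f z) ∧ ∀ z ∈ s ∩ K, 0 < f z by
    rwa [Set.inter_eq_left.2 hsK] at this
  refine hs.induction_on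
    (p := fun t => ∃ f : StrongDual ℝ (Fin d → ℝ), (∀ z ∈ K, 0 ≤ f z) ∧ ∀ z ∈ t ∩ K, 0 < f z)
    ⟨0, by simp⟩ ?mono ?union ?nhds
  case mono =>
    rintro t u htu ⟨f, hf, hfu⟩
    exact ⟨f, hf, fun z hz => hfu z ⟨htu hz.1, hz.2⟩⟩
  case union =>
    rintro t u ⟨f, hf, hft⟩ ⟨g, hg, hgu⟩
    refine ⟨f + g, fun z hz => add_nonneg (hf z hz) (hg z hz), ?_⟩
    rintro z ⟨hz | hz, hzK⟩
    · exact add_pos_of_pos_of_nonneg (hft z ⟨hz, hzK⟩) (hg z hzK)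
    · exact add_pos_of_nonneg_of_pos (hf z hzK) (hgu z ⟨hz, hzK⟩)
  case nhds =>
    intro x hx
    obtain ⟨f, hf, hfx⟩ := hK.exists_functional_pos (hsK hx) (ne_of_mem_of_not_mem hx hs0)
    exact ⟨{z | 0 < f z},
      mem_nhdsWithin_of_mem_nhds ((isOpen_lt continuous_const f.continuous).mem_nhds hfx),
      f, hf, fun z hz => hz.1⟩

theorem exists_norm_le_functional (hK : IsProperCone K) :
    ∃ f : StrongDual ℝ (Fin d → ℝ), ∀ x ∈ K, ‖x‖ ≤ f x := by
  have hcomp : IsCompact (K ∩ Metric.sphere 0 1) := (isCompact_sphere 0 1).inter_left hK.isClosed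
  obtain ⟨f, -, hfpos⟩ :=
    hK.exists_functional_pos_of_isCompact hcomp Set.inter_subset_left (by simp)
  obtain ⟨c, hc, hcf⟩ : ∃ c : ℝ, 0 < c ∧ ∀ z ∈ K ∩ Metric.sphere 0 1, c ≤ f z :=
    hcomp.exists_forall_le' f.continuous.continuousOn hfpos
  refine ⟨c⁻¹ • f, fun x hx => ?_⟩
  rcases eq_or_ne x 0 with rfl | hx0
  · simp
  have hx' : 0 < ‖x‖ := norm_pos_iff.2 hx0
  have hunit : ‖x‖⁻¹ • x ∈ K ∩ Metric.sphere 0 1 :=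
    ⟨hK.smul_mem _ (by positivity) _ hx, by simp [norm_smul, hx'.ne']⟩
  have h : c ≤ ‖x‖⁻¹ * f x := by simpa using hcf _ hunit
  rw [← div_eq_inv_mul, le_div_iff₀ hx'] at h
  simpa [← div_eq_inv_mul, le_div_iff₀ hc, mul_comm] using h

theorem exists_norm_le_dotProduct (hK : IsProperCone K) :
    ∃ y : Fin d → ℝ, ∀ x ∈ K, ‖x‖ ≤ y ⬝ᵥ x := by
  obtain ⟨f, hf⟩ := hK.exists_norm_le_functional
  obtain ⟨y, hy⟩ := (dotProductEquiv ℝ (Fin d)).surjective f.toLinearMap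
  exact ⟨y, fun x hx => (hf x hx).trans_eq (LinearMap.congr_fun hy x).symm⟩

end IsProperCone

/-- The cone of matrices that map `K` into itself: `LeavesInvariant S K` says that it contains
`S`. -/
def conePreservers {d : ℕ} (K : Set (Fin d → ℝ)) : Set (Matrix (Fin d) (Fin d) ℝ) :=
  {M | ∀ x ∈ K, M.mulVec x ∈ K}

namespace IsProperCone

variable {d : ℕ} {K : Set (Fin d → ℝ)}

theorem convex_conePreservers (hK : IsProperCone K) : Convex ℝ (conePreservers K) := by
  intro M hM N hN a b ha hb hab x hx
  rw [Matrix.add_mulVec, Matrix.smul_mulVec, Matrix.smul_mulVec]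
  exact hK.convex (hM x hx) (hN x hx) ha hb hab

open scoped Pointwise in
theorem smul_mem_interior_conePreservers (hK : IsProperCone K)
    {M : Matrix (Fin d) (Fin d) ℝ} (hM : M ∈ interior (conePreservers K)) {c : ℝ} (hc : 0 < c) :
    c • M ∈ interior (conePreservers K) := by
  have hsub : c • conePreservers K ⊆ conePreservers K := by
    rintro _ ⟨N, hN, rfl⟩ x hx
    rw [Matrix.smul_mulVec]
    exact hK.smul_mem c hc.le _ (hN x hx)
  refine interior_mono hsub ?_
  rw [interior_smul₀ hc.ne']
  exact Set.smul_mem_smul_set hM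

end IsProperCone

/-! ### Seminorms on finite-dimensional spaces -/

theorem exists_seminorm_le_mul_seminorm {V : Type*} [AddCommGroup V] [Module ℝ V]
    [FiniteDimensional ℝ V] (p q : Seminorm ℝ V) (hp : ∀ x, p x = 0 → x = 0) :
    ∃ C : ℝ, 0 < C ∧ ∀ x, q x ≤ C * p x := by
  let _ : NormedAddCommGroup V :=
    AddGroupNorm.toNormedAddCommGroup { p.toAddGroupSeminorm with eq_zero_of_map_eq_zero' := hp }
  let _ : NormedSpace ℝ V := ⟨fun a x => (map_smul_eq_mul p a x).le⟩
  exact q.bound_of_continuous_normedSpace q.convexOn.locallyLipschitz.continuous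

section MatrixNorms

variable {m n : Type*} [Finite m] [Finite n]

attribute [local instance] Matrix.normedAddCommGroup Matrix.normedSpace

theorem exists_seminorm_le_mul_of_abs_apply_le (ν : Seminorm ℝ (Matrix m n ℝ)) :
    ∃ C : ℝ, 0 < C ∧ ∀ (X : Matrix m n ℝ) (b : ℝ), 0 ≤ b → (∀ i j, |X i j| ≤ b) →
      ν X ≤ C * b := by
  cases nonempty_fintype m
  cases nonempty_fintype n
  obtain ⟨C, hC, hle⟩ := exists_seminorm_le_mul_seminorm (normSeminorm ℝ (Matrix m n ℝ)) ν
    fun X hX => norm_eq_zero.1 hX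
  exact ⟨C, hC, fun X b hb hX =>
    (hle X).trans (mul_le_mul_of_nonneg_left ((Matrix.norm_le_iff hb).2 hX) hC.le)⟩

theorem exists_abs_apply_le_mul_seminorm (ν : Seminorm ℝ (Matrix m n ℝ))
    (hν : ∀ X, ν X = 0 → X = 0) :
    ∃ C : ℝ, 0 < C ∧ ∀ (X : Matrix m n ℝ) i j, |X i j| ≤ C * ν X := by
  cases nonempty_fintype m
  cases nonempty_fintype n
  obtain ⟨C, hC, hle⟩ := exists_seminorm_le_mul_seminorm ν (normSeminorm ℝ (Matrix m n ℝ)) hν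
  exact ⟨C, hC, fun X i j => (Matrix.norm_entry_le_entrywise_sup_norm X).trans (hle X)⟩

end MatrixNorms

/-! ### Spectral radii -/

theorem tendsto_const_mul_pow_rpow_one_div {c : ℝ≥0∞} (hc0 : c ≠ 0) (hc : c ≠ ⊤) (a : ℝ≥0∞) :
    Tendsto (fun k : ℕ => (c * a ^ k) ^ (1 / (k : ℝ))) atTop (𝓝 a) := by
  have hroot : Tendsto (fun k : ℕ => c ^ (1 / (k : ℝ))) atTop (𝓝 1) := by
    have hpos : 0 < c.toReal := ENNReal.toReal_pos hc0 hc
    have h := ENNReal.tendsto_ofReal (tendsto_const_nhds.rpow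
      tendsto_one_div_atTop_nhds_zero_nat (Or.inl hpos.ne'))
    simpa only [← ENNReal.ofReal_rpow_of_pos hpos, ENNReal.ofReal_toReal hc, ENNReal.rpow_zero]
      using h
  have hmul : Tendsto (fun k : ℕ => c ^ (1 / (k : ℝ)) * a) atTop (𝓝 (1 * a)) :=
    ENNReal.Tendsto.mul_const hroot (Or.inl one_ne_zero)
  rw [one_mul] at hmul
  refine hmul.congr' ?_
  filter_upwards [eventually_ne_atTop 0] with k hk
  rw [ENNReal.mul_rpow_of_nonneg _ _ (by positivity), one_div, ENNReal.pow_rpow_inv_natCast hk]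

section SpectralRadius

variable {n : ℕ}

attribute [local instance] Matrix.linftyOpNormedRing Matrix.linftyOpNormedAlgebra

theorem tendsto_enorm_pow_rpow_matrixSpectralRadius (M : Matrix (Fin n) (Fin n) ℝ) :
    Tendsto (fun k : ℕ => ‖M ^ k‖ₑ ^ (1 / (k : ℝ))) atTop (𝓝 (matrixSpectralRadius M)) := by
  have : CompleteSpace (Matrix (Fin n) (Fin n) ℂ) := FiniteDimensional.complete ℂ _
  refine (spectrum.pow_nnnorm_pow_one_div_tendsto_nhds_spectralRadius
    (M.map (algebraMap ℝ ℂ))).congr fun k => ?_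
  have hmap : M.map (algebraMap ℝ ℂ) ^ k = (M ^ k).map (algebraMap ℝ ℂ) :=
    (map_pow (algebraMap ℝ ℂ).mapMatrix M k).symm
  rw [hmap]
  simp [enorm_eq_nnnorm, Matrix.linfty_opNNNorm_def]

theorem matrixSpectralRadius_le_of_abs_pow_le {M : Matrix (Fin n) (Fin n) ℝ} {C s : ℝ}
    (hC : 0 < C) (hs : 0 ≤ s) (h : ∀ᶠ k : ℕ in atTop, ∀ i j, |(M ^ k) i j| ≤ C * s ^ k) :
    matrixSpectralRadius M ≤ ENNReal.ofReal s := by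
  obtain ⟨B, hB, hnorm⟩ := exists_seminorm_le_mul_of_abs_apply_le
    (normSeminorm ℝ (Matrix (Fin n) (Fin n) ℝ))
  refine le_of_tendsto_of_tendsto (tendsto_enorm_pow_rpow_matrixSpectralRadius M)
    (tendsto_const_mul_pow_rpow_one_div (ENNReal.ofReal_pos.2 (mul_pos hB hC)).ne'
      ENNReal.ofReal_ne_top _) ?_
  filter_upwards [h] with k hk
  gcongr
  rw [← ofReal_norm, ← ENNReal.ofReal_pow hs, ← ENNReal.ofReal_mul (by positivity), mul_assoc]
  exact ENNReal.ofReal_le_ofReal (hnorm _ _ (by positivity) hk)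

theorem summable_pow_of_matrixSpectralRadius_lt {M : Matrix (Fin n) (Fin n) ℝ} {q : ℝ}
    (h : matrixSpectralRadius M < ENNReal.ofReal q) : Summable fun k : ℕ => (q⁻¹ • M) ^ k := by
  obtain ⟨t, ht0, hMt, htq⟩ := ENNReal.lt_iff_exists_real_btwn.1 h
  have htq' : t < q := (ENNReal.ofReal_lt_ofReal_iff_of_nonneg ht0).1 htq
  have hq : 0 < q := ht0.trans_lt htq'
  refine Summable.of_norm_bounded_eventually_nat (g := fun k => (t / q) ^ k)
    (summable_geometric_of_lt_one (by positivity) ((div_lt_one hq).2 htq')) ?_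
  filter_upwards [(tendsto_enorm_pow_rpow_matrixSpectralRadius M).eventually_lt_const hMt,
    eventually_ne_atTop 0] with k hk hk0
  have hMk : ‖M ^ k‖ ≤ t ^ k := by
    rw [one_div, ENNReal.rpow_inv_lt_iff (by positivity), ENNReal.rpow_natCast,
      ← ENNReal.ofReal_pow ht0, ← ofReal_norm] at hk
    exact (ENNReal.ofReal_lt_ofReal_iff_of_nonneg (norm_nonneg _)).1 hk |>.le
  rw [smul_pow, norm_smul, norm_pow, norm_inv, Real.norm_of_nonneg hq.le, div_pow, inv_pow,
    ← div_eq_inv_mul]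
  gcongr

end SpectralRadius

/-! ### Kronecker powers -/

section KroneckerPow

variable {d : ℕ}

theorem kroneckerPow_succ_apply (M : Matrix (Fin d) (Fin d) ℝ) (p : ℕ) (i j : Fin (d ^ (p + 1))) :
    kroneckerPow M (p + 1) i j =
      kroneckerPow M p (finProdFinEquiv.symm i).1 (finProdFinEquiv.symm j).1 *
        M (finProdFinEquiv.symm i).2 (finProdFinEquiv.symm j).2 :=
  rfl

theorem one_kroneckerPow (p : ℕ) : kroneckerPow (1 : Matrix (Fin d) (Fin d) ℝ) p = 1 := by
  induction p with
  | zero => rfl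
  | succ p ih =>
    change Matrix.reindexAlgEquiv ℝ ℝ finProdFinEquiv
      (kroneckerPow (1 : Matrix (Fin d) (Fin d) ℝ) p ⊗ₖ 1) = 1
    rw [ih, Matrix.one_kronecker_one, map_one]

theorem kroneckerPow_mul (M N : Matrix (Fin d) (Fin d) ℝ) (p : ℕ) :
    kroneckerPow (M * N) p = kroneckerPow M p * kroneckerPow N p := by
  induction p with
  | zero => exact (one_mul _).symm
  | succ p ih =>
    change Matrix.reindexAlgEquiv ℝ ℝ finProdFinEquiv (kroneckerPow (M * N) p ⊗ₖ (M * N)) =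
      Matrix.reindexAlgEquiv ℝ ℝ finProdFinEquiv (kroneckerPow M p ⊗ₖ M) *
        Matrix.reindexAlgEquiv ℝ ℝ finProdFinEquiv (kroneckerPow N p ⊗ₖ N)
    rw [ih, Matrix.mul_kronecker_mul, map_mul]

theorem continuous_kroneckerPow (p : ℕ) :
    Continuous fun M : Matrix (Fin d) (Fin d) ℝ => kroneckerPow M p := by
  induction p with
  | zero => exact continuous_const
  | succ p ih =>
    exact continuous_matrix fun i j => (ih.matrix_elem _ _).mul (continuous_id.matrix_elem _ _)

theorem abs_kroneckerPow_apply_le {M : Matrix (Fin d) (Fin d) ℝ} {b : ℝ} (h : ∀ i j, |M i j| ≤ b)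
    (p : ℕ) (i j : Fin (d ^ p)) : |kroneckerPow M p i j| ≤ b ^ p := by
  induction p with
  | zero =>
    change |(1 : Matrix (Fin (d ^ 0)) (Fin (d ^ 0)) ℝ) i j| ≤ b ^ 0
    rw [Matrix.one_apply]
    split_ifs <;> simp
  | succ p ih =>
    rw [kroneckerPow_succ_apply, abs_mul, pow_succ]
    have hi := ih (finProdFinEquiv.symm i).1 (finProdFinEquiv.symm j).1
    exact mul_le_mul hi (h _ _) (abs_nonneg _) ((abs_nonneg _).trans hi)

/-- The Kronecker power `x^{⊗p} ∈ ℝ^{d^p}` of a vector, its entries numbered as the rows of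
`kroneckerPow`. -/
def vecKroneckerPow (x : Fin d → ℝ) : (p : ℕ) → Fin (d ^ p) → ℝ
  | 0 => 1
  | p + 1 => fun i =>
      vecKroneckerPow x p (finProdFinEquiv.symm i).1 * x (finProdFinEquiv.symm i).2

theorem vecKroneckerPow_succ_apply (x : Fin d → ℝ) (p : ℕ) (i : Fin (d ^ (p + 1))) :
    vecKroneckerPow x (p + 1) i =
      vecKroneckerPow x p (finProdFinEquiv.symm i).1 * x (finProdFinEquiv.symm i).2 :=
  rfl

theorem sum_fin_pow_succ {p : ℕ} (f : Fin (d ^ p) → Fin d → ℝ) :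
    ∑ i : Fin (d ^ (p + 1)), f (finProdFinEquiv.symm i).1 (finProdFinEquiv.symm i).2 =
      ∑ a, ∑ b, f a b :=
  (finProdFinEquiv.symm.sum_comp fun i => f i.1 i.2).trans (Fintype.sum_prod_type _)

theorem kroneckerPow_mulVec (M : Matrix (Fin d) (Fin d) ℝ) (x : Fin d → ℝ) (p : ℕ) :
    (kroneckerPow M p).mulVec (vecKroneckerPow x p) = vecKroneckerPow (M.mulVec x) p := by
  induction p with
  | zero => exact Matrix.one_mulVec _
  | succ p ih =>
    ext i
    rw [vecKroneckerPow_succ_apply, ← ih]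
    simp only [Matrix.mulVec, dotProduct, kroneckerPow_succ_apply, vecKroneckerPow_succ_apply,
      mul_mul_mul_comm _ (M _ _), Finset.sum_mul_sum]
    exact sum_fin_pow_succ fun a b => kroneckerPow M p (finProdFinEquiv.symm i).1 a *
      vecKroneckerPow x p a * (M (finProdFinEquiv.symm i).2 b * x b)

theorem vecKroneckerPow_dotProduct (y x : Fin d → ℝ) (p : ℕ) :
    vecKroneckerPow y p ⬝ᵥ vecKroneckerPow x p = (y ⬝ᵥ x) ^ p := by
  induction p with
  | zero =>
    change ∑ _i : Fin 1, (1 : ℝ) * 1 = _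
    simp
  | succ p ih =>
    rw [pow_succ (y ⬝ᵥ x), ← ih]
    simp only [dotProduct, vecKroneckerPow_succ_apply, mul_mul_mul_comm _ (y _),
      Finset.sum_mul_sum]
    exact sum_fin_pow_succ fun a b => vecKroneckerPow y p a * vecKroneckerPow x p a * (y b * x b)

theorem vecKroneckerPow_smul (t : ℝ) (x : Fin d → ℝ) (p : ℕ) :
    vecKroneckerPow (t • x) p = t ^ p • vecKroneckerPow x p := by
  induction p with
  | zero =>
    rw [pow_zero t, one_smul]
    rfl
  | succ p ih =>
    ext i
    simp only [vecKroneckerPow_succ_apply, ih, Pi.smul_apply, smul_eq_mul]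
    ring

theorem continuous_vecKroneckerPow (p : ℕ) :
    Continuous fun x : Fin d → ℝ => vecKroneckerPow x p := by
  induction p with
  | zero => exact continuous_const
  | succ p ih =>
    exact continuous_pi fun i => ((continuous_apply _).comp ih).mul (continuous_apply _)

/-- The form `x ↦ w · x^{⊗p}` on `ℝ^d`, homogeneous of degree `p`, with coefficient vector `w`. -/
def kroneckerForm {p : ℕ} (w : Fin (d ^ p) → ℝ) (x : Fin d → ℝ) : ℝ :=
  w ⬝ᵥ vecKroneckerPow x p

variable {p : ℕ}

theorem kroneckerForm_vecKroneckerPow (y x : Fin d → ℝ) :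
    kroneckerForm (vecKroneckerPow y p) x = (y ⬝ᵥ x) ^ p :=
  vecKroneckerPow_dotProduct y x p

theorem kroneckerForm_smul (w : Fin (d ^ p) → ℝ) (t : ℝ) (x : Fin d → ℝ) :
    kroneckerForm w (t • x) = t ^ p * kroneckerForm w x := by
  rw [kroneckerForm, vecKroneckerPow_smul, dotProduct_smul, smul_eq_mul, kroneckerForm]

theorem add_kroneckerForm (v w : Fin (d ^ p) → ℝ) (x : Fin d → ℝ) :
    kroneckerForm (v + w) x = kroneckerForm v x + kroneckerForm w x :=
  add_dotProduct v w _

theorem smul_kroneckerForm (c : ℝ) (w : Fin (d ^ p) → ℝ) (x : Fin d → ℝ) :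
    kroneckerForm (c • w) x = c * kroneckerForm w x :=
  smul_dotProduct c w _

theorem continuous_kroneckerForm (w : Fin (d ^ p) → ℝ) : Continuous (kroneckerForm w) :=
  continuous_const.dotProduct (continuous_vecKroneckerPow p)

end KroneckerPow

/-! ### Expected Kronecker powers -/

section ExpectedKroneckerPow

variable {d : ℕ} {μ : Measure (Matrix (Fin d) (Fin d) ℝ)}

instance matrixSecondCountableTopology :
    SecondCountableTopology (Matrix (Fin d) (Fin d) ℝ) :=
  inferInstanceAs (SecondCountableTopology (Fin d → Fin d → ℝ))

variable [IsFiniteMeasure μ]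

theorem integrable_of_isCompact_support {E : Type*} [NormedAddCommGroup E]
    (hμ : IsCompact μ.support) {f : Matrix (Fin d) (Fin d) ℝ → E} (hf : Continuous f) :
    Integrable f μ := by
  obtain ⟨C, hC⟩ := hμ.exists_bound_of_continuousOn hf.continuousOn
  refine Integrable.of_bound hf.aestronglyMeasurable C ?_
  filter_upwards [Measure.support_mem_ae] with A hA using hC A hA

attribute [local instance] Matrix.normedAddCommGroup Matrix.normedSpace in
theorem map_expectedKroneckerPow (hμ : IsCompact μ.support) {p : ℕ}
    (l : Matrix (Fin (d ^ p)) (Fin (d ^ p)) ℝ →ₗ[ℝ] ℝ) :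
    l (expectedKroneckerPow μ p) = ∫ A, l (kroneckerPow A p) ∂μ := by
  have hint := integrable_of_isCompact_support (E := Matrix (Fin (d ^ p)) (Fin (d ^ p)) ℝ) hμ
    (continuous_kroneckerPow p)
  have hE : expectedKroneckerPow μ p = ∫ A, kroneckerPow A p ∂μ := by
    ext i j
    exact (Matrix.entryLinearMap ℝ ℝ i j).toContinuousLinearMap.integral_comp_comm hint
  rw [hE]
  exact (l.toContinuousLinearMap.integral_comp_comm hint).symm

theorem abs_map_expectedKroneckerPow_pow_le (hμ : IsCompact μ.support) {p : ℕ} (k : ℕ) {c : ℝ}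
    (l : Matrix (Fin (d ^ p)) (Fin (d ^ p)) ℝ →ₗ[ℝ] ℝ)
    (h : ∀ L : List (Matrix (Fin d) (Fin d) ℝ), L.length = k → (∀ A ∈ L, A ∈ μ.support) →
      |l (kroneckerPow L.prod p)| ≤ c) :
    |l (expectedKroneckerPow μ p ^ k)| ≤ c * μ.real Set.univ ^ k := by
  induction k generalizing l with
  | zero => simpa [one_kroneckerPow] using h [] rfl
  | succ k ih =>
    let l' := l ∘ₗ LinearMap.mulRight ℝ (expectedKroneckerPow μ p ^ k)
    have hl' : l (expectedKroneckerPow μ p ^ (k + 1)) = l' (expectedKroneckerPow μ p) := by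
      simp [l', pow_succ']
    rw [hl', map_expectedKroneckerPow hμ, ← Real.norm_eq_abs, pow_succ, ← mul_assoc]
    refine norm_integral_le_of_norm_le_const ?_
    filter_upwards [Measure.support_mem_ae] with A hA
    refine ih (l ∘ₗ LinearMap.mulLeft ℝ (kroneckerPow A p)) fun L hL hLs => ?_
    simpa [kroneckerPow_mul] using h (A :: L) (by simpa using hL) (by simpa [hA] using hLs)

theorem kroneckerForm_vecMul_expectedKroneckerPow (hμ : IsCompact μ.support) {p : ℕ}
    (w : Fin (d ^ p) → ℝ) (x : Fin d → ℝ) :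
    kroneckerForm (Matrix.vecMul w (expectedKroneckerPow μ p)) x =
      ∫ A, kroneckerForm w (A.mulVec x) ∂μ := by
  let l : Matrix (Fin (d ^ p)) (Fin (d ^ p)) ℝ →ₗ[ℝ] ℝ :=
    dotProductBilin ℝ ℝ w ∘ₗ (Matrix.mulVecBilin ℝ ℝ).flip (vecKroneckerPow x p)
  have hl : ∀ X, l X = w ⬝ᵥ X.mulVec (vecKroneckerPow x p) := fun _ => rfl
  have h := map_expectedKroneckerPow hμ l
  simp only [hl, kroneckerPow_mulVec, Matrix.dotProduct_mulVec] at h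
  exact h

end ExpectedKroneckerPow

/-! ### Monotone convex functions on a cone -/

section MonotoneConvex

variable {V : Type*} [AddCommGroup V] [Module ℝ V] {K : Set V}

/-- Nonnegative convex functions on the cone `K` that are monotone for the order whose positive
cone is `K`. -/
structure IsMonotoneConvexOn (K : Set V) (f : V → ℝ) : Prop where
  nonneg : ∀ x ∈ K, 0 ≤ f x
  le_add : ∀ x ∈ K, ∀ z ∈ K, f x ≤ f (x + z)
  convexOn : ConvexOn ℝ K f

namespace IsMonotoneConvexOn

theorem of_linearMap (hK : Convex ℝ K) (l : V →ₗ[ℝ] ℝ) (hl : ∀ x ∈ K, 0 ≤ l x) :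
    IsMonotoneConvexOn K l where
  nonneg := hl
  le_add x _ z hz := by simpa using hl z hz
  convexOn := l.convexOn hK

variable {f : V → ℝ}

theorem pow (hf : IsMonotoneConvexOn K f) (p : ℕ) : IsMonotoneConvexOn K (fun x => f x ^ p) where
  nonneg x hx := pow_nonneg (hf.nonneg x hx) p
  le_add x hx z hz := pow_le_pow_left₀ (hf.nonneg x hx) (hf.le_add x hx z hz) p
  convexOn := hf.convexOn.pow (fun x hx => hf.nonneg x hx) p

theorem const_mul (hf : IsMonotoneConvexOn K f) {c : ℝ} (hc : 0 ≤ c) :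
    IsMonotoneConvexOn K (fun x => c * f x) where
  nonneg x hx := mul_nonneg hc (hf.nonneg x hx)
  le_add x hx z hz := mul_le_mul_of_nonneg_left (hf.le_add x hx z hz) hc
  convexOn := hf.convexOn.smul hc

theorem comp_linearMap (hf : IsMonotoneConvexOn K f) (hK : Convex ℝ K) (T : V →ₗ[ℝ] V)
    (hT : Set.MapsTo T K K) : IsMonotoneConvexOn K (f ∘ T) where
  nonneg x hx := hf.nonneg _ (hT hx)
  le_add x hx z hz := by simpa using hf.le_add _ (hT hx) _ (hT hz)
  convexOn := (hf.convexOn.comp_linearMap T).subset hT hK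

theorem hasSum {ι : Type*} {g : ι → V → ℝ} (hK : Convex ℝ K) (hadd : ∀ x ∈ K, ∀ z ∈ K, x + z ∈ K)
    (hg : ∀ i, IsMonotoneConvexOn K (g i)) (hf : ∀ x ∈ K, HasSum (fun i => g i x) (f x)) :
    IsMonotoneConvexOn K f where
  nonneg x hx := (hf x hx).nonneg fun i => (hg i).nonneg x hx
  le_add x hx z hz :=
    hasSum_le (fun i => (hg i).le_add x hx z hz) (hf x hx) (hf _ (hadd x hx z hz))
  convexOn := ⟨hK, fun x hx z hz a b ha hb hab =>
    hasSum_le (fun i => (hg i).convexOn.2 hx hz ha hb hab) (hf _ (hK hx hz ha hb hab))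
      (((hf x hx).mul_left a).add ((hf z hz).mul_left b))⟩

theorem integral {α : Type*} [MeasurableSpace α] {μ : Measure α} {g : α → V → ℝ} (hK : Convex ℝ K)
    (hadd : ∀ x ∈ K, ∀ z ∈ K, x + z ∈ K) (hg : ∀ᵐ a ∂μ, IsMonotoneConvexOn K (g a))
    (hint : ∀ x ∈ K, Integrable (fun a => g a x) μ) :
    IsMonotoneConvexOn K (fun x => ∫ a, g a x ∂μ) where
  nonneg x hx := integral_nonneg_of_ae (hg.mono fun _ h => h.nonneg x hx)
  le_add x hx z hz := integral_mono_ae (hint x hx) (hint _ (hadd x hx z hz))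
    (hg.mono fun _ h => h.le_add x hx z hz)
  convexOn := ⟨hK, fun x hx z hz a b ha hb hab => by
    have hx' := (hint x hx).const_mul a
    have hz' := (hint z hz).const_mul b
    rw [smul_eq_mul, smul_eq_mul, ← integral_const_mul, ← integral_const_mul,
      ← integral_add hx' hz']
    exact integral_mono_ae (hint _ (hK hx hz ha hb hab)) (hx'.add hz')
      (hg.mono fun _ h => h.convexOn.2 hx hz ha hb hab)⟩

theorem le_of_le_add_smul (hf : IsMonotoneConvexOn K f) {p : ℕ}
    (hom : ∀ (t : ℝ) x, f (t • x) = t ^ p * f x) {ε c : ℝ} (hε : 0 ≤ ε) {u v z : V} (hu : u ∈ K)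
    (hv : v ∈ K) (hz : z ∈ K) (hle : u + ε • v - z ∈ K) (hfu : f u ≤ c) (hfv : f v ≤ c) :
    f z ≤ (1 + ε) ^ p * c := by
  have hε' : 0 < 1 + ε := by positivity
  have hsum : (1 + ε)⁻¹ + (1 + ε)⁻¹ * ε = 1 := by field_simp
  calc f z ≤ f (z + (u + ε • v - z)) := hf.le_add z hz _ hle
    _ = f ((1 + ε) • ((1 + ε)⁻¹ • u + ((1 + ε)⁻¹ * ε) • v)) := by
        rw [smul_add, mul_smul, smul_inv_smul₀ hε'.ne', smul_inv_smul₀ hε'.ne', add_sub_cancel]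
    _ = (1 + ε) ^ p * f ((1 + ε)⁻¹ • u + ((1 + ε)⁻¹ * ε) • v) := hom _ _
    _ ≤ (1 + ε) ^ p * ((1 + ε)⁻¹ * f u + ((1 + ε)⁻¹ * ε) * f v) := by
        gcongr
        exact hf.convexOn.2 hu hv (by positivity) (by positivity) hsum
    _ ≤ (1 + ε) ^ p * ((1 + ε)⁻¹ * c + ((1 + ε)⁻¹ * ε) * c) := by gcongr
    _ = (1 + ε) ^ p * c := by rw [← add_mul, hsum, one_mul]

end IsMonotoneConvexOn

end MonotoneConvex

/-! ### The resolvent of the expected Kronecker power -/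

section Resolvent

variable {d p : ℕ} {μ : Measure (Matrix (Fin d) (Fin d) ℝ)} [IsFiniteMeasure μ]
  {K : Set (Fin d → ℝ)}

theorem integrable_kroneckerForm_mulVec (hμ : IsCompact μ.support) (w : Fin (d ^ p) → ℝ)
    (x : Fin d → ℝ) : Integrable (fun A => kroneckerForm w (A.mulVec x)) μ :=
  integrable_of_isCompact_support hμ
    ((continuous_kroneckerForm w).comp (continuous_id.matrix_mulVec continuous_const))

theorem IsMonotoneConvexOn.kroneckerForm_vecMul (hK : IsProperCone K)
    (hμ : IsCompact μ.support) (hinv : LeavesInvariant μ.support K) {w : Fin (d ^ p) → ℝ}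
    (hw : IsMonotoneConvexOn K (kroneckerForm w)) :
    IsMonotoneConvexOn K (kroneckerForm (Matrix.vecMul w (expectedKroneckerPow μ p))) := by
  rw [funext (kroneckerForm_vecMul_expectedKroneckerPow hμ w)]
  refine .integral hK.convex (fun _ hx _ hz => hK.add_mem hx hz) ?_
    fun x _ => integrable_kroneckerForm_mulVec hμ w x
  filter_upwards [Measure.support_mem_ae] with A hA
  exact hw.comp_linearMap hK.convex A.mulVecLin (hinv A hA)

theorem isMonotoneConvexOn_kroneckerForm_vecMul_pow (hK : IsProperCone K)
    (hμ : IsCompact μ.support) (hinv : LeavesInvariant μ.support K) {y : Fin d → ℝ}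
    (hy : ∀ x ∈ K, 0 ≤ y ⬝ᵥ x) {c : ℝ} (hc : 0 ≤ c) (k : ℕ) :
    IsMonotoneConvexOn K (kroneckerForm
      (Matrix.vecMul (vecKroneckerPow y p) ((c • expectedKroneckerPow μ p) ^ k))) := by
  induction k with
  | zero =>
    rw [pow_zero, Matrix.vecMul_one, funext (kroneckerForm_vecKroneckerPow y)]
    exact (IsMonotoneConvexOn.of_linearMap hK.convex (dotProductBilin ℝ ℝ y) hy).pow p
  | succ k ih =>
    rw [pow_succ, ← Matrix.vecMul_vecMul, Matrix.vecMul_smul, funext (smul_kroneckerForm c _)]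
    exact (ih.kroneckerForm_vecMul hK hμ hinv).const_mul hc

theorem exists_kroneckerForm_resolvent (hK : IsProperCone K) (hμ : IsCompact μ.support)
    (hinv : LeavesInvariant μ.support K) {y : Fin d → ℝ} (hy : ∀ x ∈ K, 0 ≤ y ⬝ᵥ x) {q : ℝ}
    (hq : matrixSpectralRadius (expectedKroneckerPow μ p) < ENNReal.ofReal q) :
    ∃ w : Fin (d ^ p) → ℝ, IsMonotoneConvexOn K (kroneckerForm w) ∧
      ∀ x, kroneckerForm w x = (y ⬝ᵥ x) ^ p + q⁻¹ * ∫ A, kroneckerForm w (A.mulVec x) ∂μ := by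
  have hq0 : 0 < q := ENNReal.ofReal_pos.1 (hq.trans_le' zero_le)
  let B := q⁻¹ • expectedKroneckerPow μ p
  have hsum : Summable fun k : ℕ => B ^ k := summable_pow_of_matrixSpectralRadius_lt hq
  let u := vecKroneckerPow y p
  let w := Matrix.vecMul u (∑' k : ℕ, B ^ k)
  have hmono (k : ℕ) : IsMonotoneConvexOn K (kroneckerForm (Matrix.vecMul u (B ^ k))) :=
    isMonotoneConvexOn_kroneckerForm_vecMul_pow hK hμ hinv hy (inv_nonneg.2 hq0.le) k
  have hasSum_form (x : Fin d → ℝ) :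
      HasSum (fun k : ℕ => kroneckerForm (Matrix.vecMul u (B ^ k)) x) (kroneckerForm w x) :=
    let l : Matrix (Fin (d ^ p)) (Fin (d ^ p)) ℝ →ₗ[ℝ] ℝ :=
      (dotProductBilin ℝ ℝ).flip (vecKroneckerPow x p) ∘ₗ Matrix.vecMulBilin ℝ ℝ u
    hsum.hasSum.map l l.continuous_of_finiteDimensional
  have hw : w = u + q⁻¹ • Matrix.vecMul w (expectedKroneckerPow μ p) := by
    have hR : ∑' k : ℕ, B ^ k = 1 + (∑' k : ℕ, B ^ k) * B := by
      rw [← sub_eq_iff_eq_add, ← mul_one_sub]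
      exact hsum.tsum_pow_mul_one_sub
    calc w = Matrix.vecMul u (1 + (∑' k : ℕ, B ^ k) * B) := congrArg (Matrix.vecMul u) hR
      _ = u + q⁻¹ • Matrix.vecMul w (expectedKroneckerPow μ p) := by
        rw [Matrix.vecMul_add, Matrix.vecMul_one, ← Matrix.vecMul_vecMul, Matrix.vecMul_smul]
  refine ⟨w, .hasSum hK.convex (fun _ hx _ hz => hK.add_mem hx hz) hmono
    fun x _ => hasSum_form x, fun x => ?_⟩
  conv_lhs => rw [hw, add_kroneckerForm, smul_kroneckerForm,
    kroneckerForm_vecMul_expectedKroneckerPow hμ, kroneckerForm_vecKroneckerPow]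

end Resolvent

/-! ### Local domination in the support -/

theorem measureReal_pos_of_mem_nhdsWithin_support {X : Type*} [TopologicalSpace X]
    [MeasurableSpace X] [HereditarilyLindelofSpace X] {μ : Measure X} [IsFiniteMeasure μ] {x : X}
    (hx : x ∈ μ.support) {s : Set X} (hs : s ∈ 𝓝[μ.support] x) : 0 < μ.real s := by
  obtain ⟨u, hu, hus⟩ := mem_nhdsWithin_iff_exists_mem_nhds_inter.1 hs
  refine ENNReal.toReal_pos (ne_of_gt ?_) (measure_ne_top μ s)
  refine ((Measure.mem_support_iff_forall x).1 hx u hu).trans_le ?_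
  rw [← measure_inter_conull (s := u) Measure.measure_compl_support]
  exact measure_mono hus

theorem exists_mem_le_integral_div {α : Type*} [MeasurableSpace α] {μ : Measure α} {f : α → ℝ}
    (hf : Integrable f μ) (hf0 : 0 ≤ᵐ[μ] f) {s : Set α} {m : ℝ} (hm : 0 < m) (hs : m ≤ μ.real s) :
    ∃ a ∈ s, f a ≤ (∫ a, f a ∂μ) / m := by
  have hs0 : 0 < μ.real s := hm.trans_le hs
  obtain ⟨hμs, hμs'⟩ : μ s ≠ 0 ∧ μ s ≠ ⊤ := by
    rw [Measure.real, ENNReal.toReal_pos_iff] at hs0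
    exact ⟨hs0.1.ne', hs0.2.ne⟩
  obtain ⟨a, ha, hle⟩ := exists_le_setAverage hμs hμs' hf.integrableOn
  refine ⟨a, ha, hle.trans ?_⟩
  rw [setAverage_eq, smul_eq_mul, ← div_eq_inv_mul]
  exact div_le_div₀ (integral_nonneg_of_ae hf0) (setIntegral_le_integral hf hf0) hm hs

section LocalDomination

variable {d : ℕ} {μ : Measure (Matrix (Fin d) (Fin d) ℝ)} {K : Set (Fin d → ℝ)} {ε m : ℝ}
  {M : Matrix (Fin d) (Fin d) ℝ}

/-- In the order whose positive cone is `conePreservers K`, the matrix `M` is dominated by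
`B + ε • A`, where `B` and `A` range independently over subsets of the support of measure at
least `m`. -/
def IsDominated (K : Set (Fin d → ℝ)) (μ : Measure (Matrix (Fin d) (Fin d) ℝ)) (ε m : ℝ)
    (M : Matrix (Fin d) (Fin d) ℝ) : Prop :=
  ∃ s ⊆ μ.support, ∃ t ⊆ μ.support, m ≤ μ.real s ∧ m ≤ μ.real t ∧
    ∀ B ∈ s, ∀ A ∈ t, B + ε • A - M ∈ conePreservers K

theorem IsDominated.anti (h : IsDominated K μ ε m M) {m' : ℝ} (hm : m' ≤ m) :
    IsDominated K μ ε m' M := by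
  obtain ⟨s, hs, t, ht, hms, hmt, hdom⟩ := h
  exact ⟨s, hs, t, ht, hm.trans hms, hm.trans hmt, hdom⟩

/-- For every `ε > 0`, all matrices of the support near a given one are dominated by sets of a
common positive measure. This is the form in which the shape of the singular part of
`μ` enters the proof. -/
def IsLocallyDominated (K : Set (Fin d → ℝ)) (μ : Measure (Matrix (Fin d) (Fin d) ℝ)) : Prop :=
  ∀ ε : ℝ, 0 < ε → ∀ A₀ ∈ μ.support, ∃ m : ℝ, 0 < m ∧
    ∀ᶠ M in 𝓝[μ.support] A₀, IsDominated K μ ε m M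

theorem IsLocallyDominated.exists_forall_isDominated (h : IsLocallyDominated K μ)
    (hμ : IsCompact μ.support) (hε : 0 < ε) :
    ∃ m : ℝ, 0 < m ∧ ∀ M ∈ μ.support, IsDominated K μ ε m M := by
  refine hμ.induction_on (p := fun U => ∃ m : ℝ, 0 < m ∧ ∀ M ∈ U, IsDominated K μ ε m M)
    ⟨1, one_pos, by simp⟩ ?mono ?union ?nhds
  case mono =>
    rintro U V hUV ⟨m, hm, hV⟩
    exact ⟨m, hm, fun M hM => hV M (hUV hM)⟩
  case union =>
    rintro U V ⟨m, hm, hU⟩ ⟨n, hn, hV⟩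
    refine ⟨min m n, lt_min hm hn, ?_⟩
    rintro M (hM | hM)
    · exact (hU M hM).anti (min_le_left m n)
    · exact (hV M hM).anti (min_le_right m n)
  case nhds =>
    intro A₀ hA₀
    obtain ⟨m, hm, hdom⟩ := h ε hε A₀ hA₀
    exact ⟨_, hdom, m, hm, fun M hM => hM⟩

theorem SingularPartIsFinitelyAtomic.finite_support_of_mutuallySingular
    (h : SingularPartIsFinitelyAtomic μ) (hμ : μ ⟂ₘ matrixLebesgue d) : μ.support.Finite := by
  obtain ⟨N, w, M, -, hμs⟩ := h
  rw [Measure.singularPart_eq_self.2 hμ] at hμs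
  refine (Set.finite_range M).subset
    (Measure.support_subset_of_isClosed (Set.finite_range M).isClosed ?_)
  rw [mem_ae_iff, hμs, Measure.finsetSum_apply]
  simp [Measure.dirac_apply' _ (Set.finite_range M).isClosed.measurableSet.compl]

theorem mutuallySingular_of_disjoint_interior_conePreservers (hK : IsProperCone K)
    (hinv : LeavesInvariant μ.support K)
    (hdisj : Disjoint μ.support (interior (conePreservers K))) : μ ⟂ₘ matrixLebesgue d := by
  have hnull : matrixLebesgue d (frontier (conePreservers K)) = 0 :=
    Convex.addHaar_frontier (E := Fin d → Fin d → ℝ) volume hK.convex_conePreservers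
  have hsupp : μ.support ⊆ frontier (conePreservers K) := fun A hA =>
    ⟨subset_closure (hinv A hA), Set.disjoint_left.1 hdisj hA⟩
  refine .symm ⟨frontier (conePreservers K), isClosed_frontier.measurableSet, hnull, ?_⟩
  exact measure_mono_null (Set.compl_subset_compl.2 hsupp) Measure.measure_compl_support

variable [IsFiniteMeasure μ]

theorem IsProperCone.isLocallyDominated_of_mem_interior (hK : IsProperCone K)
    {A₁ : Matrix (Fin d) (Fin d) ℝ} (hA₁ : A₁ ∈ μ.support)
    (hint : A₁ ∈ interior (conePreservers K)) : IsLocallyDominated K μ := by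
  intro ε hε A₀ hA₀
  have hcont : Tendsto (fun q : Matrix (Fin d) (Fin d) ℝ × Matrix (Fin d) (Fin d) ℝ ×
      Matrix (Fin d) (Fin d) ℝ => q.2.1 + ε • q.2.2 - q.1)
      (𝓝[μ.support] A₀ ×ˢ 𝓝[μ.support] A₀ ×ˢ 𝓝[μ.support] A₁) (𝓝 (A₀ + ε • A₁ - A₀)) := by
    refine (Continuous.tendsto (by fun_prop) (A₀, A₀, A₁)).mono_left ?_
    rw [nhds_prod_eq, nhds_prod_eq]
    gcongr <;> exact nhdsWithin_le_nhds
  have hmem : conePreservers K ∈ 𝓝 (A₀ + ε • A₁ - A₀) := by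
    rw [add_sub_cancel_left, ← mem_interior_iff_mem_nhds]
    exact hK.smul_mem_interior_conePreservers hint hε
  obtain ⟨u, hu, v, hv, huv⟩ := mem_prod_iff.1 (hcont hmem)
  obtain ⟨s, hs, t, ht, hst⟩ := mem_prod_iff.1 hv
  have hspos := measureReal_pos_of_mem_nhdsWithin_support hA₀ (inter_mem hs self_mem_nhdsWithin)
  have htpos := measureReal_pos_of_mem_nhdsWithin_support hA₁ (inter_mem ht self_mem_nhdsWithin)
  refine ⟨_, lt_min hspos htpos, ?_⟩
  filter_upwards [hu] with M hM
  exact ⟨s ∩ μ.support, Set.inter_subset_right, t ∩ μ.support, Set.inter_subset_right,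
    min_le_left _ _, min_le_right _ _, fun B hB A hA =>
      huv (Set.mk_mem_prod hM (hst (Set.mk_mem_prod hB.1 hA.1)))⟩

theorem isLocallyDominated_of_finite_support (hK : IsProperCone K)
    (hinv : LeavesInvariant μ.support K) (hfin : μ.support.Finite) : IsLocallyDominated K μ := by
  intro ε hε A₀ hA₀
  have hsing : {A₀} ∈ 𝓝[μ.support] A₀ := by
    refine mem_nhdsWithin.2 ⟨(μ.support \ {A₀})ᶜ,
      (hfin.subset Set.sdiff_subset).isClosed.isOpen_compl, by simp, fun M hM => ?_⟩
    by_contra hne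
    exact hM.1 ⟨hM.2, hne⟩
  have hsub : {A₀} ⊆ μ.support := Set.singleton_subset_iff.2 hA₀
  refine ⟨μ.real {A₀}, measureReal_pos_of_mem_nhdsWithin_support hA₀ hsing, ?_⟩
  filter_upwards [hsing]
  rintro _ rfl
  refine ⟨_, hsub, _, hsub, le_rfl, le_rfl, ?_⟩
  rintro _ rfl _ rfl x hx
  rw [add_sub_cancel_left, Matrix.smul_mulVec]
  exact hK.smul_mem ε hε.le _ (hinv _ hA₀ x hx)

theorem SingularPartIsFinitelyAtomic.isLocallyDominated
    (h : SingularPartIsFinitelyAtomic μ) (hK : IsProperCone K)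
    (hinv : LeavesInvariant μ.support K) : IsLocallyDominated K μ := by
  by_cases hdisj : Disjoint μ.support (interior (conePreservers K))
  · exact isLocallyDominated_of_finite_support hK hinv (h.finite_support_of_mutuallySingular
      (mutuallySingular_of_disjoint_interior_conePreservers hK hinv hdisj))
  · obtain ⟨A₁, hA₁, hint⟩ := Set.not_disjoint_iff.1 hdisj
    exact hK.isLocallyDominated_of_mem_interior hA₁ hint

variable {p : ℕ}

-- Taking `B` and `A` where the form is at most its average costs a factor `1 / m`, which is
-- independent of `p` and therefore disappears after taking `p`-th roots.
theorem IsDominated.kroneckerForm_mulVec_le (h : IsDominated K μ ε m M)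
    (hμ : IsCompact μ.support) (hinv : LeavesInvariant μ.support K) (hm : 0 < m) (hε : 0 ≤ ε)
    {w : Fin (d ^ p) → ℝ} (hw : IsMonotoneConvexOn K (kroneckerForm w)) (hM : M ∈ conePreservers K)
    {x : Fin d → ℝ} (hx : x ∈ K) :
    kroneckerForm w (M.mulVec x) ≤
      (1 + ε) ^ p * ((∫ A, kroneckerForm w (A.mulVec x) ∂μ) / m) := by
  obtain ⟨s, hs, t, ht, hms, hmt, hdom⟩ := h
  have hint := integrable_kroneckerForm_mulVec hμ w x
  have hnonneg : 0 ≤ᵐ[μ] fun A => kroneckerForm w (A.mulVec x) := by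
    filter_upwards [Measure.support_mem_ae] with A hA using hw.nonneg _ (hinv A hA x hx)
  obtain ⟨B, hB, hBle⟩ := exists_mem_le_integral_div hint hnonneg hm hms
  obtain ⟨A, hA, hAle⟩ := exists_mem_le_integral_div hint hnonneg hm hmt
  refine hw.le_of_le_add_smul (kroneckerForm_smul w) hε (hinv B (hs hB) x hx)
    (hinv A (ht hA) x hx) (hM x hx) ?_ hBle hAle
  rw [← Matrix.smul_mulVec, ← Matrix.add_mulVec, ← Matrix.sub_mulVec]
  exact hdom B hB A hA x hx

theorem exists_lyapunov_kroneckerForm (hK : IsProperCone K) (hμ : IsCompact μ.support)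
    (hinv : LeavesInvariant μ.support K) (hm : 0 < m) (hε : 0 ≤ ε)
    (hdom : ∀ M ∈ μ.support, IsDominated K μ ε m M) {q : ℝ}
    (hq : matrixSpectralRadius (expectedKroneckerPow μ p) < ENNReal.ofReal q) :
    ∃ w : Fin (d ^ p) → ℝ, (∀ x ∈ K, ‖x‖ ^ p ≤ kroneckerForm w x) ∧
      ∀ A ∈ μ.support, ∀ x ∈ K,
        kroneckerForm w (A.mulVec x) ≤ (1 + ε) ^ p * (q / m) * kroneckerForm w x := by
  have hq0 : 0 < q := ENNReal.ofReal_pos.1 (hq.trans_le' zero_le)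
  obtain ⟨y, hy⟩ := hK.exists_norm_le_dotProduct
  have hy0 : ∀ x ∈ K, 0 ≤ y ⬝ᵥ x := fun x hx => (norm_nonneg x).trans (hy x hx)
  obtain ⟨w, hw, hres⟩ := exists_kroneckerForm_resolvent hK hμ hinv hy0 hq
  refine ⟨w, fun x hx => ?_, fun A hA x hx => ?_⟩
  · have hnonneg : 0 ≤ ∫ A, kroneckerForm w (A.mulVec x) ∂μ := by
      refine integral_nonneg_of_ae ?_
      filter_upwards [Measure.support_mem_ae] with A hA using hw.nonneg _ (hinv A hA x hx)
    rw [hres]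
    exact (pow_le_pow_left₀ (norm_nonneg x) (hy x hx) p).trans
      (le_add_of_nonneg_right (by positivity))
  · have hmean : ∫ A, kroneckerForm w (A.mulVec x) ∂μ ≤ q * kroneckerForm w x := by
      rw [← inv_mul_le_iff₀ hq0, hres x]
      exact le_add_of_nonneg_left (pow_nonneg (hy0 x hx) p)
    calc kroneckerForm w (A.mulVec x)
        ≤ (1 + ε) ^ p * ((∫ A, kroneckerForm w (A.mulVec x) ∂μ) / m) :=
          (hdom A hA).kroneckerForm_mulVec_le hμ hinv hm hε hw (hinv A hA) hx
      _ ≤ (1 + ε) ^ p * (q * kroneckerForm w x / m) := by gcongr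
      _ = (1 + ε) ^ p * (q / m) * kroneckerForm w x := by ring

end LocalDomination

/-! ### The joint spectral radius -/

section JointSpectralRadius

variable {d : ℕ} {ν : Seminorm ℝ (Matrix (Fin d) (Fin d) ℝ)} {S : Set (Matrix (Fin d) (Fin d) ℝ)}

theorem jointSpectralRadius_le_of_le {C r : ℝ} (hC : 0 < C) (hr : 0 ≤ r)
    (h : ∀ L : List (Matrix (Fin d) (Fin d) ℝ), (∀ A ∈ L, A ∈ S) → ν L.prod ≤ C * r ^ L.length) :
    jointSpectralRadius ν S ≤ ENNReal.ofReal r := by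
  have hlim := tendsto_const_mul_pow_rpow_one_div (ENNReal.ofReal_pos.2 hC).ne'
    ENNReal.ofReal_ne_top (ENNReal.ofReal r)
  rw [← hlim.limsup_eq]
  refine limsup_le_limsup (Eventually.of_forall fun k => iSup₂_le fun A hA => ?_)
  refine ENNReal.rpow_le_rpow ?_ (by positivity)
  rw [← ENNReal.ofReal_pow hr, ← ENNReal.ofReal_mul hC.le]
  simpa using ENNReal.ofReal_le_ofReal (h (List.ofFn fun i : Fin k => A i.rev)
    (List.forall_mem_ofFn_iff.2 fun i => hA _))

theorem eventually_le_of_jointSpectralRadius_lt {b : ℝ}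
    (h : jointSpectralRadius ν S < ENNReal.ofReal b) :
    ∀ᶠ k : ℕ in atTop, ∀ L : List (Matrix (Fin d) (Fin d) ℝ), L.length = k → (∀ A ∈ L, A ∈ S) →
      ν L.prod ≤ b ^ k := by
  have hb : 0 < b := ENNReal.ofReal_pos.1 (h.trans_le' zero_le)
  filter_upwards [eventually_lt_of_limsup_lt h, eventually_ne_atTop 0] with k hk hk0 L hL hLS
  subst hL
  have hsup : ENNReal.ofReal (ν L.prod) ^ (1 / (L.length : ℝ)) ≤ ENNReal.ofReal b := by
    simpa using (le_iSup₂ (f := fun (A : Fin L.length → Matrix (Fin d) (Fin d) ℝ)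
      (_ : ∀ i, A i ∈ S) => ENNReal.ofReal (ν (List.ofFn fun i : Fin L.length => A i.rev).prod) ^
        (1 / (L.length : ℝ))) (fun i => L.get i.rev) fun i => hLS _ (L.get_mem _)).trans hk.le
  rwa [one_div, ENNReal.rpow_inv_le_iff (by positivity), ENNReal.rpow_natCast,
    ← ENNReal.ofReal_pow hb.le, ENNReal.ofReal_le_ofReal_iff (by positivity)] at hsup

/-- The vectors `x` whose orbits grow at most like `s ^ k` under products of `k` matrices
from `S`. -/
def growthSubmodule (S : Set (Matrix (Fin d) (Fin d) ℝ)) (s : ℝ) : Submodule ℝ (Fin d → ℝ) where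
  carrier := {x | ∃ C : ℝ, ∀ L : List (Matrix (Fin d) (Fin d) ℝ), (∀ A ∈ L, A ∈ S) →
    ‖L.prod.mulVec x‖ ≤ C * s ^ L.length}
  add_mem' := by
    rintro x y ⟨C, hC⟩ ⟨D, hD⟩
    refine ⟨C + D, fun L hL => ?_⟩
    rw [Matrix.mulVec_add, add_mul]
    exact norm_add_le_of_le (hC L hL) (hD L hL)
  zero_mem' := ⟨0, by simp⟩
  smul_mem' := by
    rintro c x ⟨C, hC⟩
    refine ⟨‖c‖ * C, fun L hL => ?_⟩
    rw [Matrix.mulVec_smul, norm_smul, mul_assoc]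
    exact mul_le_mul_of_nonneg_left (hC L hL) (norm_nonneg c)

theorem jointSpectralRadius_le_of_growthSubmodule_eq_top {s : ℝ} (hs : 0 ≤ s)
    (h : growthSubmodule S s = ⊤) : jointSpectralRadius ν S ≤ ENNReal.ofReal s := by
  have hbasis (j : Fin d) : Pi.single j 1 ∈ growthSubmodule S s := h ▸ Submodule.mem_top
  choose D hD using hbasis
  obtain ⟨C, hC, hν⟩ := exists_seminorm_le_mul_of_abs_apply_le ν
  have hB : 0 < 1 + ∑ j, |D j| := by positivity
  refine jointSpectralRadius_le_of_le (mul_pos hC hB) hs fun L hL => ?_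
  rw [mul_assoc]
  refine hν _ _ (by positivity) fun i j => ?_
  calc |L.prod i j| = ‖L.prod.mulVec (Pi.single j 1) i‖ := by simp
    _ ≤ ‖L.prod.mulVec (Pi.single j 1)‖ := norm_le_pi_norm _ i
    _ ≤ D j * s ^ L.length := hD j L hL
    _ ≤ (1 + ∑ j, |D j|) * s ^ L.length := by
        gcongr
        exact (le_abs_self _).trans (le_add_of_nonneg_of_le zero_le_one
          (Finset.single_le_sum (fun j _ => abs_nonneg (D j)) (Finset.mem_univ j)))

variable {K : Set (Fin d → ℝ)}

theorem mem_growthSubmodule_of_lyapunov (hinv : LeavesInvariant S K) {Φ : (Fin d → ℝ) → ℝ} {s : ℝ}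
    {p : ℕ} (hp : p ≠ 0) (hs : 0 ≤ s) (hΦ : ∀ x ∈ K, ‖x‖ ^ p ≤ Φ x)
    (hstep : ∀ A ∈ S, ∀ x ∈ K, Φ (A.mulVec x) ≤ s ^ p * Φ x) {x : Fin d → ℝ} (hx : x ∈ K) :
    x ∈ growthSubmodule S s := by
  have horbit (L : List (Matrix (Fin d) (Fin d) ℝ)) (hL : ∀ A ∈ L, A ∈ S) :
      L.prod.mulVec x ∈ K ∧ Φ (L.prod.mulVec x) ≤ (s ^ p) ^ L.length * Φ x := by
    induction L with
    | nil => simpa using hx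
    | cons A L ih =>
      obtain ⟨hA, hL⟩ := List.forall_mem_cons.1 hL
      obtain ⟨hK, hle⟩ := ih hL
      rw [List.prod_cons, ← Matrix.mulVec_mulVec, List.length_cons, pow_succ', mul_assoc]
      exact ⟨hinv A hA _ hK, (hstep A hA _ hK).trans
        (mul_le_mul_of_nonneg_left hle (pow_nonneg hs p))⟩
  have hΦx : 0 ≤ Φ x := (pow_nonneg (norm_nonneg x) p).trans (hΦ x hx)
  refine ⟨1 + Φ x, fun L hL => le_of_pow_le_pow_left₀ hp (by positivity) ?_⟩
  calc ‖L.prod.mulVec x‖ ^ p ≤ (s ^ p) ^ L.length * Φ x :=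
        (hΦ _ (horbit L hL).1).trans (horbit L hL).2
    _ ≤ (s ^ p) ^ L.length * (1 + Φ x) ^ p := by
        gcongr
        exact (le_add_of_nonneg_left zero_le_one).trans
          (le_self_pow₀ (le_add_of_nonneg_right hΦx) hp)
    _ = ((1 + Φ x) * s ^ L.length) ^ p := by
        rw [mul_pow, ← pow_mul, ← pow_mul, mul_comm p, mul_comm]

theorem jointSpectralRadius_le_of_lyapunov (hsolid : (interior K).Nonempty)
    (hinv : LeavesInvariant S K) {Φ : (Fin d → ℝ) → ℝ} {s : ℝ} {p : ℕ} (hp : p ≠ 0) (hs : 0 ≤ s)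
    (hΦ : ∀ x ∈ K, ‖x‖ ^ p ≤ Φ x)
    (hstep : ∀ A ∈ S, ∀ x ∈ K, Φ (A.mulVec x) ≤ s ^ p * Φ x) :
    jointSpectralRadius ν S ≤ ENNReal.ofReal s := by
  have hsub : K ⊆ growthSubmodule S s := fun x hx =>
    mem_growthSubmodule_of_lyapunov hinv hp hs hΦ hstep hx
  exact jointSpectralRadius_le_of_growthSubmodule_eq_top hs
    (Submodule.eq_top_of_nonempty_interior' _ (hsolid.mono (interior_mono hsub)))

attribute [local instance] Matrix.linftyOpNormedAddCommGroup in
theorem jointSpectralRadius_ne_top_of_isCompact (hS : IsCompact S) :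
    jointSpectralRadius ν S ≠ ⊤ := by
  obtain ⟨B, hB⟩ := hS.exists_bound_of_continuousOn
    (E := Matrix (Fin d) (Fin d) ℝ) continuousOn_id
  have hbound : ∀ A ∈ S, ∀ x ∈ Set.univ, ‖A.mulVec x‖ ≤ max B 0 ^ 1 * ‖x‖ := fun A hA x _ => by
    rw [pow_one]
    exact (Matrix.linfty_opNorm_mulVec A x).trans
      (mul_le_mul_of_nonneg_right ((hB A hA).trans (le_max_left B 0)) (norm_nonneg x))
  exact ne_top_of_le_ne_top ENNReal.ofReal_ne_top (jointSpectralRadius_le_of_lyapunov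
    (by simp) (fun _ _ _ _ => Set.mem_univ _) one_ne_zero (le_max_right B 0)
    (fun x _ => (pow_one ‖x‖).le) hbound)

end JointSpectralRadius

/-! ### Comparison of the two spectral radii -/

section Comparison

variable {d : ℕ} {μ : Measure (Matrix (Fin d) (Fin d) ℝ)} [IsFiniteMeasure μ]
  {ν : Seminorm ℝ (Matrix (Fin d) (Fin d) ℝ)} {K : Set (Fin d → ℝ)}

theorem matrixSpectralRadius_expectedKroneckerPow_le (hμ : IsCompact μ.support)
    (hν : ∀ X, ν X = 0 → X = 0) {b : ℝ}
    (hb : jointSpectralRadius ν μ.support < ENNReal.ofReal b) (p : ℕ) :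
    matrixSpectralRadius (expectedKroneckerPow μ p) ≤ ENNReal.ofReal (μ.real Set.univ * b ^ p) := by
  have hb0 : 0 < b := ENNReal.ofReal_pos.1 (hb.trans_le' zero_le)
  obtain ⟨C, hC, hCν⟩ := exists_abs_apply_le_mul_seminorm ν hν
  refine matrixSpectralRadius_le_of_abs_pow_le (pow_pos hC p) (by positivity) ?_
  filter_upwards [eventually_le_of_jointSpectralRadius_lt hb] with k hk i j
  calc |(expectedKroneckerPow μ p ^ k) i j| ≤ (C * b ^ k) ^ p * μ.real Set.univ ^ k := by
        refine abs_map_expectedKroneckerPow_pow_le hμ k (Matrix.entryLinearMap ℝ ℝ i j)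
          fun L hL hLs => abs_kroneckerPow_apply_le (fun a b => (hCν _ a b).trans ?_) p i j
        gcongr
        exact hk L hL hLs
    _ = C ^ p * (μ.real Set.univ * b ^ p) ^ k := by ring

theorem limsup_matrixSpectralRadius_le_jointSpectralRadius (hμ : IsCompact μ.support)
    (hν : ∀ X, ν X = 0 → X = 0) :
    limsup (fun p : ℕ => matrixSpectralRadius (expectedKroneckerPow μ p) ^ (1 / (p : ℝ))) atTop ≤
      jointSpectralRadius ν μ.support := by
  refine le_of_forall_gt_imp_ge_of_dense fun a ha => ?_
  obtain ⟨b, hb0, hb, hba⟩ := ENNReal.lt_iff_exists_real_btwn.1 ha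
  have hlim := tendsto_const_mul_pow_rpow_one_div (c := μ Set.univ + 1) (by simp) (by simp)
    (ENNReal.ofReal b)
  refine (limsup_le_limsup (Eventually.of_forall fun p => ?_)).trans
    (hlim.limsup_eq.trans_le hba.le)
  refine ENNReal.rpow_le_rpow ?_ (by positivity)
  calc matrixSpectralRadius (expectedKroneckerPow μ p)
      ≤ ENNReal.ofReal (μ.real Set.univ * b ^ p) :=
        matrixSpectralRadius_expectedKroneckerPow_le hμ hν hb p
    _ = μ Set.univ * ENNReal.ofReal b ^ p := by
        rw [ENNReal.ofReal_mul measureReal_nonneg, ofReal_measureReal, ENNReal.ofReal_pow hb0]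
    _ ≤ (μ Set.univ + 1) * ENNReal.ofReal b ^ p := by
        gcongr
        exact le_self_add

theorem jointSpectralRadius_le_of_frequently_matrixSpectralRadius_lt (hK : IsProperCone K)
    (hμ : IsCompact μ.support) (hinv : LeavesInvariant μ.support K)
    (hdom : IsLocallyDominated K μ) {r r' : ℝ} (hr : 0 < r) (hrr' : r < r')
    (hfreq : ∃ᶠ p : ℕ in atTop,
      matrixSpectralRadius (expectedKroneckerPow μ p) < ENNReal.ofReal (r ^ p)) :
    jointSpectralRadius ν μ.support ≤ ENNReal.ofReal r' := by
  have hr' : 0 < r' := hr.trans hrr'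
  obtain ⟨ε, hε, hεr⟩ : ∃ ε : ℝ, 0 < ε ∧ (1 + ε) * r < r' := by
    obtain ⟨c, hrc, hcr'⟩ := exists_between hrr'
    exact ⟨c / r - 1, by rwa [sub_pos, one_lt_div hr], by
      rwa [add_sub_cancel, div_mul_cancel₀ _ hr.ne']⟩
  obtain ⟨m, hm, hdom'⟩ := hdom.exists_forall_isDominated hμ hε
  have hsmall : ∀ᶠ p : ℕ in atTop, (1 + ε) ^ p * (r ^ p / m) ≤ r' ^ p := by
    have hlim : Tendsto (fun p : ℕ => ((1 + ε) * r / r') ^ p) atTop (𝓝 0) :=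
      tendsto_pow_atTop_nhds_zero_of_lt_one (by positivity) ((div_lt_one hr').2 hεr)
    filter_upwards [hlim.eventually_le_const hm] with p hp
    rwa [div_pow, div_le_iff₀' (by positivity), ← div_le_iff₀ hm, mul_pow, mul_div_assoc] at hp
  obtain ⟨p, hρ, hp, hp0⟩ :=
    (hfreq.and_eventually (hsmall.and (eventually_ne_atTop 0))).exists
  obtain ⟨w, hnorm, hstep⟩ := exists_lyapunov_kroneckerForm hK hμ hinv hm hε.le hdom' hρ
  refine jointSpectralRadius_le_of_lyapunov hK.solid hinv hp0 hr'.le hnorm fun A hA x hx => ?_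
  exact (hstep A hA x hx).trans (mul_le_mul_of_nonneg_right hp
    ((pow_nonneg (norm_nonneg x) p).trans (hnorm x hx)))

theorem jointSpectralRadius_le_liminf_matrixSpectralRadius (hK : IsProperCone K)
    (hμ : IsCompact μ.support) (hinv : LeavesInvariant μ.support K)
    (hdom : IsLocallyDominated K μ) :
    jointSpectralRadius ν μ.support ≤
      liminf (fun p : ℕ => matrixSpectralRadius (expectedKroneckerPow μ p) ^ (1 / (p : ℝ)))
        atTop := by
  refine le_of_forall_gt_imp_ge_of_dense fun a ha => ?_
  obtain ⟨r', -, hr', hr'a⟩ := ENNReal.lt_iff_exists_real_btwn.1 ha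
  obtain ⟨r, hr0, hr, hrr'⟩ := ENNReal.lt_iff_exists_real_btwn.1 hr'
  have hrpos : 0 < r := ENNReal.ofReal_pos.1 (hr.trans_le' zero_le)
  refine (jointSpectralRadius_le_of_frequently_matrixSpectralRadius_lt hK hμ hinv hdom hrpos
    ((ENNReal.ofReal_lt_ofReal_iff_of_nonneg hr0).1 hrr') ?_).trans hr'a.le
  refine ((frequently_lt_of_liminf_lt (by isBoundedDefault) hr).and_eventually
    (eventually_ne_atTop 0)).mono fun p ⟨hp, hp0⟩ => ?_
  rwa [one_div, ENNReal.rpow_inv_lt_iff (by positivity), ENNReal.rpow_natCast,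
    ← ENNReal.ofReal_pow hr0] at hp

theorem mainTheorem5_general (hμ : IsCompact μ.support) (hK : IsProperCone K)
    (hinv : LeavesInvariant μ.support K) (hdom : IsLocallyDominated K μ)
    (hν : ∀ X, ν X = 0 → X = 0) :
    jointSpectralRadius ν μ.support ≠ ⊤ ∧
      Tendsto (fun p : ℕ => matrixSpectralRadius (expectedKroneckerPow μ p) ^ (1 / (p : ℝ))) atTop
        (𝓝 (jointSpectralRadius ν μ.support)) :=
  ⟨jointSpectralRadius_ne_top_of_isCompact hμ, tendsto_of_le_liminf_of_limsup_le
    (jointSpectralRadius_le_liminf_matrixSpectralRadius hK hμ hinv hdom)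
    (limsup_matrixSpectralRadius_le_jointSpectralRadius hμ hν)⟩

end Comparison

theorem mainTheorem5 (d : ℕ) (μ : Measure (Matrix (Fin d) (Fin d) ℝ)) [IsProbabilityMeasure μ]
    (hcompact : IsCompact μ.support)
    (hcone : ∃ K : Set (Fin d → ℝ), IsProperCone K ∧ LeavesInvariant μ.support K)
    (hsing : SingularPartIsFinitelyAtomic μ)
    (ν : Seminorm ℝ (Matrix (Fin d) (Fin d) ℝ)) (hν : ∀ X, ν X = 0 → X = 0) :
    jointSpectralRadius ν μ.support ≠ ⊤ ∧
      Tendsto (fun p : ℕ => matrixSpectralRadius (expectedKroneckerPow μ p) ^ (1 / (p : ℝ))) atTop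
        (𝓝 (jointSpectralRadius ν μ.support)) := by
  obtain ⟨K, hK, hinv⟩ := hcone
  exact mainTheorem5_general hcompact hK hinv (hsing.isLocallyDominated hK hinv) hν
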